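/- Let $k$ be a field and let $G$ be a group $k$-functor, that is, a functor from the category of commutative $k$-algebras to the category of groups. A $G$-module is a $k$-vector space $V$ with $R$-linear actions of the groups $G(R)$ on $V\otimes_k R$, one for each commutative $k$-algebra $R$, such that for every algebra homomorphism $\varphi:R\to R'$ and every $g\in G(R)$ the element $G(\varphi)(g)$ acts on $V\otimes_k R'$ as the $R'$-linear extension of $g$. A subspace $W\subseteq V$ is $G$-stable if $W\otimes_k R$ is stable under $G(R)$ for every $R$. Let $A$ be a commutative $k$-algebra on which $G$ operates by automorphisms, i.e. $A$ is a $G$-module and each $G(R)$ acts on $A\otimes_k R$ by algebra automorphisms; $A$ is called $G$-simple if it has no nonzero proper $G$-stable ideals. An $A,G$-module is an $A$-module $M$ with a $G$-module structure such that $g(am)=(ga)(gm)$ for all commutative $k$-algebras $R$ and all $g\in G(R)$, $a\in A\otimes_k R$, $m\in M\otimes_k R$; its $A,G$-submodules are its $G$-stable $A$-submodules. It is locally $A$-finite if it is the union of its $A,G$-submodules that are finitely generated over $A$. Let $M$ be a locally $A$-finite $A,G$-module. If $P$ is a prime ideal of $A$ containing no nonzero $G$-stable ideal of $A$, then the localization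 $M_P$ is a free module over the local ring $A_P$. If $A$ is $G$-simple, then $M$ is a projective $A$-module. -/

import Mathlib

open CategoryTheory
open scoped TensorProduct

universe u v w u₁ u₂

namespace GroupFunctor

/-- A group `k`-functor: a functor from commutative `k`-algebras to groups. -/
abbrev GroupKFunctor (k : Type u) [Field k] := CommAlgCat.{v} k ⥤ GrpCat.{w}

variable {k : Type u} [Field k]

/-- A `G`-module structure on a `k`-vector space `V`: for each commutative `k`-algebra `R` an
`R`-linear action of the group `G(R)` on `R ⊗ V`, compatible with algebra homomorphisms
`φ : R → R'`. Since `R' ⊗ V` is generated over `R'` by the image of `φ ⊗ id`, the condition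
`act_map` says that `G(φ)(g)` acts as the `R'`-linear extension of the action of `g`. -/
structure GModule (G : GroupKFunctor.{u, v, w} k) (V : Type u₂)
    [AddCommGroup V] [Module k V] where
  /-- The `R`-linear action of `G(R)` on `R ⊗ V`. -/
  act (R : CommAlgCat.{v} k) : G.obj R →* Module.End R (R ⊗[k] V)
  act_map {R R' : CommAlgCat.{v} k} (φ : R ⟶ R') (g : G.obj R) (x : R ⊗[k] V) :
    act R' ((G.map φ).hom g) (φ.hom.toLinearMap.rTensor V x) =
      φ.hom.toLinearMap.rTensor V (act R g x)

/-- A `k`-subspace `W` of a `G`-module `V` is `G`-stable if the image `R ⊗ W` of `W` under scalar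
extension is stable under `G(R)` for each commutative `k`-algebra `R`. -/
def GModule.IsStable {G : GroupKFunctor.{u, v, w} k} {V : Type u₂}
    [AddCommGroup V] [Module k V] (ρ : GModule G V) (W : Submodule k V) : Prop :=
  ∀ (R : CommAlgCat.{v} k) (g : G.obj R) (x : R ⊗[k] V),
    x ∈ W.baseChange R → ρ.act R g x ∈ W.baseChange R

/-- An action of `G` by automorphisms on a commutative `k`-algebra `A`: a `G`-module structure for
which each `G(R)` acts on `R ⊗ A` by algebra automorphisms. -/
structure AlgebraAction (G : GroupKFunctor.{u, v, w} k) (A : Type u₁)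
    [CommRing A] [Algebra k A] extends GModule G A where
  act_one (R : CommAlgCat.{v} k) (g : G.obj R) : act R g 1 = 1
  act_mul (R : CommAlgCat.{v} k) (g : G.obj R) (a b : R ⊗[k] A) :
    act R g (a * b) = act R g a * act R g b

section

variable {G : GroupKFunctor.{u, v, w} k} {A : Type u₁} [CommRing A] [Algebra k A]

/-- An ideal of `A` is `G`-stable if its underlying subspace is. -/
def AlgebraAction.IsStableIdeal (α : AlgebraAction G A) (I : Ideal A) : Prop :=
  α.toGModule.IsStable (I.restrictScalars k)

/-- `A` is `G`-simple if it has no nonzero proper `G`-stable ideals. -/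
def AlgebraAction.IsGSimple (α : AlgebraAction G A) : Prop :=
  ∀ I : Ideal A, α.IsStableIdeal I → I = ⊥ ∨ I = ⊤

/-- The multiplication of elements of `R ⊗ M` by elements of `R ⊗ A`, given on pure tensors by
`(r ⊗ a)(s ⊗ m) = rs ⊗ am`. -/
noncomputable def tensorSMul (R : Type v) [CommRing R] [Algebra k R]
    (A : Type u₁) [CommRing A] [Algebra k A]
    (M : Type u₂) [AddCommGroup M] [Module k M] [Module A M] [IsScalarTower k A M] :
    R ⊗[k] A →ₗ[k] R ⊗[k] M →ₗ[k] R ⊗[k] M :=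
  TensorProduct.map₂ (LinearMap.mul k R) (Algebra.lsmul k k M).toLinearMap

theorem tensorSMul_tmul (R : Type v) [CommRing R] [Algebra k R]
    (M : Type u₂) [AddCommGroup M] [Module k M] [Module A M] [IsScalarTower k A M]
    (r s : R) (a : A) (m : M) :
    tensorSMul R A M (r ⊗ₜ[k] a) (s ⊗ₜ[k] m) = (r * s) ⊗ₜ[k] (a • m) := rfl

/-- An `A,G`-module structure on the `A`-module `M`: a `G`-module structure satisfying
`g(am) = (ga)(gm)` for all `g ∈ G(R)`, `a ∈ R ⊗ A`, `m ∈ R ⊗ M`. -/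
structure AGModule (α : AlgebraAction G A) (M : Type u₂)
    [AddCommGroup M] [Module k M] [Module A M] [IsScalarTower k A M] extends GModule G M where
  act_smul (R : CommAlgCat.{v} k) (g : G.obj R) (a : R ⊗[k] A) (m : R ⊗[k] M) :
    act R g (tensorSMul R A M a m) = tensorSMul R A M (α.act R g a) (act R g m)

variable {α : AlgebraAction G A} {M : Type u₂}
    [AddCommGroup M] [Module k M] [Module A M] [IsScalarTower k A M]

/-- An `A,G`-submodule of `M` is an `A`-submodule that is `G`-stable. -/
def AGModule.IsAGSubmodule (μ : AGModule α M) (N : Submodule A M) : Prop :=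
  μ.toGModule.IsStable (N.restrictScalars k)

/-- `M` is locally `A`-finite: it is the union of its `A,G`-submodules which are finitely
generated as `A`-modules. -/
def AGModule.IsLocallyFinite (μ : AGModule α M) : Prop :=
  ∀ m : M, ∃ N : Submodule A M, μ.IsAGSubmodule N ∧ N.FG ∧ m ∈ N

end

end GroupFunctor

/-! Fitting ideals carry the argument. Let `N` and `F` be stable, with `F` generated over `A` by
`x₁, …, xₙ`. The tuples `u` with `∑ uᵢ xᵢ ∈ N` present `(N + F)/N`. Determinants whose rows in `S`
are such relations, the other rows being arbitrary, generate the ideal of minors of size `|S|` of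
the relations. Up to padding the generators by zeros, this ideal is independent of the choice of
generators (`relationIdeal_le_of_span_eq`). It also commutes with the flat extension `A → R ⊗ A`
(`map_relationIdeal_includeRight`). An element of `G(R)` carries one generating tuple of `R ⊗ F` to
another, so the ideal is `G`-stable (`AGModule.isStableIdeal_relationIdeal`).

If `A` is `G`-simple, each such ideal is `0` or `A`; in the local case each is `0` or becomes the
unit ideal of `A_P`. A maximal `S` with unit ideal therefore has vanishing larger minors, and
Cramer's rule splits the presentation (`projective_of_minorIdeal`). So `(N + F)/N` is projective,
and over the local ring `A_P` its analogue is free.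

Local finiteness then lets `N` grow by such direct complements until it exhausts `M`, so the module
is a direct sum of projective or free pieces. -/

/-! ### Direct sum decompositions and complements -/

/-- If every proper member `N` of a family of submodules closed under suprema can be enlarged inside
the family by a direct complement satisfying `p`, then the module is the direct sum of submodules
satisfying `p`. -/
theorem Submodule.exists_sSupIndep_sSup_eq_top {B : Type*} {X : Type*} [Ring B] [AddCommGroup X]
    [Module B X] (T : Set (Submodule B X)) (p : Submodule B X → Prop)
    (hT : ∀ s ⊆ T, sSup s ∈ T)
    (h : ∀ N ∈ T, ∀ m : X, ∃ C, p C ∧ Disjoint N C ∧ N ⊔ C ∈ T ∧ m ∈ N ⊔ C) :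
    ∃ s : Set (Submodule B X), sSupIndep s ∧ sSup s = ⊤ ∧ ∀ C ∈ s, p C := by
  obtain ⟨s, hs⟩ := zorn_subset {s : Set (Submodule B X) | sSupIndep s ∧ sSup s ∈ T ∧ ∀ C ∈ s, p C}
    (by
      intro c hc hchain
      refine ⟨⋃₀ c, ⟨?_, ?_, ?_⟩, fun _ => Set.subset_sUnion_of_mem⟩
      · rw [Set.sUnion_eq_iUnion]
        exact sSupIndep_iUnion_of_directed hchain.directed fun i => (hc i.2).1
      · rw [sSup_sUnion, ← sSup_image]
        refine hT _ ?_
        rintro _ ⟨t, ht, rfl⟩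
        exact (hc ht).2.1
      · rintro C ⟨t, ht, hC⟩
        exact (hc ht).2.2 C hC)
  obtain ⟨hind, hmem, hp⟩ := hs.prop
  refine ⟨s, hind, ?_, hp⟩
  rw [eq_top_iff]
  intro m _
  obtain ⟨C, hpC, hdisj, hsup, hm⟩ := h _ hmem m
  -- Adjoining `C` keeps the family independent, so by maximality `C` already belongs to `s`.
  have hsub : insert C s ⊆ s := by
    refine hs.le_of_ge ⟨?_, ?_, ?_⟩ (Set.subset_insert _ _)
    · intro a ha
      rcases Set.mem_insert_iff.mp ha with rfl | ha
      · refine hdisj.symm.mono_right (sSup_le_sSup ?_)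
        rintro b ⟨hb, hba⟩
        exact (Set.mem_insert_iff.mp hb).resolve_left hba
      · have h1 : Disjoint a (sSup (s \ {a}) ⊔ C) := by
          refine (hind ha).disjoint_sup_right_of_disjoint_sup_left (hdisj.mono_left ?_)
          exact sup_le (le_sSup ha) (sSup_le_sSup Set.sdiff_subset)
        refine h1.mono_right (sSup_le ?_)
        rintro b ⟨hb, hba⟩
        rcases Set.mem_insert_iff.mp hb with rfl | hb
        · exact le_sup_right
        · exact le_sup_of_le_left (le_sSup ⟨hb, hba⟩)
    · rw [sSup_insert, sup_comm]
      exact hsup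
    · rintro D hD
      rcases Set.mem_insert_iff.mp hD with rfl | hD
      exacts [hpC, hp D hD]
  rwa [sup_eq_left.mpr (le_sSup (hsub (Set.mem_insert C s)))] at hm

theorem Submodule.exists_linearEquiv_directSum {B : Type*} {X : Type*} [Ring B]
    [AddCommGroup X] [Module B X] {s : Set (Submodule B X)} (hs : sSupIndep s) (h : sSup s = ⊤) :
    Nonempty ((DirectSum s fun C => (C : Submodule B X)) ≃ₗ[B] X) := by
  classical
  have := DirectSum.isInternal_submodule_of_iSupIndep_of_iSup_eq_top
    (A := fun C : s => (C : Submodule B X)) ((sSupIndep_iff s).mp hs)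
    (by rw [← sSup_eq_iSup', h])
  exact ⟨LinearEquiv.ofBijective (DirectSum.coeLinearMap _) this⟩

/-- If the image of `F` in the quotient by `N` is projective, it lifts to a complement of `N`
in `N ⊔ F`. -/
theorem Submodule.exists_disjoint_sup_eq_of_projective {B : Type*} {X : Type*} [Ring B]
    [AddCommGroup X] [Module B X] (N F : Submodule B X) [Module.Projective B (F.map N.mkQ)] :
    ∃ C : Submodule B X, Nonempty (F.map N.mkQ ≃ₗ[B] C) ∧ Disjoint N C ∧ N ⊔ C = N ⊔ F := by
  let f : F →ₗ[B] F.map N.mkQ := N.mkQ.submoduleMap F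
  have hf : Function.Surjective f := N.mkQ.submoduleMap_surjective F
  obtain ⟨s, hs⟩ := Module.projective_lifting_property f LinearMap.id hf
  have hs' (q) : N.mkQ (s q : X) = q := congrArg Subtype.val (LinearMap.congr_fun hs q)
  let g : F.map N.mkQ →ₗ[B] X := F.subtype ∘ₗ s
  have hg : Function.Injective g := by
    intro a b hab
    apply Subtype.ext
    rw [← hs' a, ← hs' b]
    exact congrArg N.mkQ hab
  refine ⟨LinearMap.range g, ⟨LinearEquiv.ofInjective g hg⟩, ?_, ?_⟩
  · rw [Submodule.disjoint_def]
    rintro _ hN ⟨q, rfl⟩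
    have h0 : N.mkQ (s q : X) = 0 := (Submodule.Quotient.mk_eq_zero N).mpr hN
    rw [hs'] at h0
    rw [show q = 0 from Subtype.ext h0, map_zero]
  · refine le_antisymm (sup_le le_sup_left ?_) (sup_le le_sup_left ?_)
    · rintro _ ⟨q, rfl⟩
      exact Submodule.mem_sup_right (s q).2
    · intro x hx
      have : x - g (f ⟨x, hx⟩) ∈ N := by
        rw [← Submodule.Quotient.mk_eq_zero N]
        change N.mkQ (x - s (f ⟨x, hx⟩)) = 0
        rw [map_sub, hs', sub_eq_zero]
        rfl
      rw [← sub_add_cancel x (g (f ⟨x, hx⟩))]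
      exact Submodule.add_mem_sup this ⟨_, rfl⟩

/-! ### Ideals of minors and Cramer's rule -/

/-- A multilinear map sends tuples with entries in given spans into an ideal as soon as it does so
for the generators. -/
theorem MultilinearMap.mem_of_mem_span {B ι : Type*} [CommRing B] [Finite ι] {E : ι → Type*}
    [∀ i, AddCommGroup (E i)] [∀ i, Module B (E i)] (f : MultilinearMap B E B)
    (s : ∀ i, Set (E i)) (I : Ideal B) (h : ∀ v, (∀ i, v i ∈ s i) → f v ∈ I) (v : ∀ i, E i)
    (hv : ∀ i, v i ∈ Submodule.span B (s i)) : f v ∈ I := by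
  classical
  cases nonempty_fintype ι
  -- Induction on the set `t` of positions allowed to range over the span; the other positions hold
  -- generators.
  suffices H : ∀ (t : Finset ι) (v : ∀ i, E i), (∀ i ∈ t, v i ∈ Submodule.span B (s i)) →
      (∀ i ∉ t, v i ∈ s i) → f v ∈ I from
    H Finset.univ v (fun i _ => hv i) (fun i hi => absurd (Finset.mem_univ i) hi)
  intro t
  induction t using Finset.induction_on with
  | empty => exact fun v _ h' => h v fun i => h' i (Finset.notMem_empty i)
  | insert j t hj ih =>
    intro v h1 h2
    have key : Submodule.span B (s j) ≤ Submodule.comap (f.toLinearMap v j) I := by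
      rw [Submodule.span_le]
      intro x hx
      refine ih _ (fun i hi => ?_) (fun i hi => ?_)
      · have hij : i ≠ j := fun e => hj (e ▸ hi)
        rw [Function.update_of_ne hij]
        exact h1 i (Finset.mem_insert_of_mem hi)
      · by_cases hij : i = j
        · subst hij
          rwa [Function.update_self]
        · rw [Function.update_of_ne hij]
          exact h2 i (by simp [hij, hi])
    have := key (h1 j (Finset.mem_insert_self j t))
    simpa using this

/-- The ideal generated by the determinants whose rows indexed by `S` lie in `K`. -/
def minorIdeal {B ι : Type*} [CommRing B] [Fintype ι] [DecidableEq ι] (K : Submodule B (ι → B))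
    (S : Finset ι) : Ideal B :=
  Ideal.span {d | ∃ v : Matrix ι ι B, (∀ i ∈ S, v i ∈ K) ∧ v.det = d}

section minorIdeal

variable {B ι : Type*} [CommRing B] [Fintype ι] [DecidableEq ι]

theorem det_mem_minorIdeal {K : Submodule B (ι → B)} {S : Finset ι} {v : Matrix ι ι B}
    (hv : ∀ i ∈ S, v i ∈ K) : v.det ∈ minorIdeal K S :=
  Ideal.subset_span ⟨v, hv, rfl⟩

theorem minorIdeal_empty (K : Submodule B (ι → B)) : minorIdeal K ∅ = ⊤ := by
  rw [Ideal.eq_top_iff_one, ← Matrix.det_one (n := ι)]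
  exact det_mem_minorIdeal (by simp)

/-- Applying `U` to every row multiplies the determinant by the unit `det U`. -/
theorem minorIdeal_le_of_linearEquiv {K K' : Submodule B (ι → B)} (U : (ι → B) ≃ₗ[B] (ι → B))
    (h : ∀ u ∈ K, U u ∈ K') (S : Finset ι) : minorIdeal K S ≤ minorIdeal K' S := by
  rw [minorIdeal, Ideal.span_le]
  rintro _ ⟨v, hv, rfl⟩
  have hdet : (Matrix.of fun i => U (v i)).det =
      LinearMap.det (U : (ι → B) →ₗ[B] (ι → B)) * v.det := by
    have := (Pi.basisFun B ι).det_comp (U : (ι → B) →ₗ[B] (ι → B)) v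
    rw [Pi.basisFun_det] at this
    exact this
  have hunit : IsUnit (LinearMap.det (U : (ι → B) →ₗ[B] (ι → B))) := U.isUnit_det'
  have hmem : (Matrix.of fun i => U (v i)).det ∈ minorIdeal K' S :=
    det_mem_minorIdeal fun i hi => h _ (hv i hi)
  rw [hdet] at hmem
  exact (Ideal.unit_mul_mem_iff_mem _ hunit).mp hmem

theorem map_minorIdeal_le {B' : Type*} [CommRing B'] (f : B →+* B') {K : Submodule B (ι → B)}
    {K' : Submodule B' (ι → B')} (h : ∀ u ∈ K, f ∘ u ∈ K') (S : Finset ι) :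
    (minorIdeal K S).map f ≤ minorIdeal K' S := by
  rw [minorIdeal, Ideal.map_span, Ideal.span_le]
  rintro _ ⟨_, ⟨v, hv, rfl⟩, rfl⟩
  rw [RingHom.map_det]
  exact det_mem_minorIdeal fun i hi => h _ (hv i hi)

theorem minorIdeal_le_map {B' : Type*} [CommRing B'] (f : B →+* B') {K : Submodule B (ι → B)}
    {K' : Submodule B' (ι → B')}
    (h : K' ≤ Submodule.span B' ((fun u : ι → B => f ∘ u) '' K)) (S : Finset ι) :
    minorIdeal K' S ≤ (minorIdeal K S).map f := by
  rw [minorIdeal, Ideal.span_le]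
  rintro _ ⟨v, hv, rfl⟩
  -- By multilinearity it is enough to take rows coming from `B`: images of elements of `K` in the
  -- positions of `S`, and images of arbitrary vectors elsewhere, where the standard basis already
  -- spans.
  refine (Matrix.detRowAlternating (n := ι) (R := B')).toMultilinearMap.mem_of_mem_span
    (fun i => (fun u : ι → B => f ∘ u) '' {u | i ∈ S → u ∈ K}) _ ?_ v ?_
  · intro w hw
    choose u hu huw using hw
    have : w = f.mapMatrix (Matrix.of u) := by
      ext i j
      exact (congrFun (huw i) j).symm
    rw [this]
    change (f.mapMatrix (Matrix.of u)).det ∈ _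
    rw [← RingHom.map_det]
    exact Ideal.mem_map_of_mem f (det_mem_minorIdeal hu)
  · intro i
    by_cases hi : i ∈ S
    · simpa [hi] using! h (hv i hi)
    · rw [pi_eq_sum_univ (v i)]
      refine Submodule.sum_mem _ fun j _ => Submodule.smul_mem _ _ (Submodule.subset_span ?_)
      refine ⟨Pi.single j 1, fun h => absurd h hi, ?_⟩
      ext l
      simp [Pi.single_apply, eq_comm, apply_ite f]

/-- If the minors through `S` generate the unit ideal and all larger minors vanish, then the
quotient by `K` is projective, by Cramer's rule. -/
theorem projective_of_minorIdeal {Q : Type*} [AddCommGroup Q] [Module B Q] (φ : (ι → B) →ₗ[B] Q)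
    (hφ : Function.Surjective φ) (S : Finset ι) (h1 : minorIdeal (LinearMap.ker φ) S = ⊤)
    (h0 : ∀ j ∉ S, minorIdeal (LinearMap.ker φ) (insert j S) = ⊥) : Module.Projective B Q := by
  -- `J` consists of the scalars `b` for which multiplication by `b` on `Q` lifts through `φ`. A
  -- splitting of `φ` exists exactly when `1 ∈ J`.
  let J : Ideal B :=
    { carrier := {b | ∃ s : Q →ₗ[B] (ι → B), φ ∘ₗ s = b • LinearMap.id}
      add_mem' := by
        rintro a b ⟨s, hs⟩ ⟨t, ht⟩
        exact ⟨s + t, by rw [LinearMap.comp_add, hs, ht, add_smul]⟩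
      zero_mem' := ⟨0, by simp⟩
      smul_mem' := by
        rintro c a ⟨s, hs⟩
        exact ⟨c • s, by rw [LinearMap.comp_smul, hs, smul_eq_mul, mul_smul]⟩ }
  have hJ : minorIdeal (LinearMap.ker φ) S ≤ J := by
    rw [minorIdeal, Ideal.span_le]
    rintro _ ⟨v, hv, rfl⟩
    -- Cramer's rule writes `det v • u` as a combination of the rows of `v`. The rows in `S` die
    -- under `φ`, so dropping them leaves `φ (t u) = det v • φ u`.
    let t : (ι → B) →ₗ[B] (ι → B) :=
      ∑ i ∈ Sᶜ, (LinearMap.proj i ∘ₗ v.transpose.cramer).smulRight (v i)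
    have ht (u) : t u = ∑ i ∈ Sᶜ, v.transpose.cramer u i • v i := by simp [t]
    have hker : LinearMap.ker φ ≤ LinearMap.ker t := by
      intro u hu
      rw [LinearMap.mem_ker, ht]
      refine Finset.sum_eq_zero fun j hj => ?_
      rw [Finset.mem_compl] at hj
      -- The coefficient of `v j` is the determinant with row `j` replaced by `u ∈ ker φ`, a minor
      -- through `insert j S`.
      have : (v.updateRow j u).det ∈ minorIdeal (LinearMap.ker φ) (insert j S) := by
        refine det_mem_minorIdeal fun i hi => ?_
        by_cases hij : i = j
        · subst hij
          simpa using! hu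
        · have := hv i ((Finset.mem_insert.mp hi).resolve_left hij)
          rwa [Matrix.updateRow_ne hij]
      rw [h0 j hj, Ideal.mem_bot] at this
      rw [Matrix.cramer_transpose_apply, this, zero_smul]
    have hφt (u) : φ (t u) = v.det • φ u := by
      have h := Matrix.mulVec_cramer v.transpose u
      rw [Matrix.det_transpose, Matrix.mulVec_transpose, Matrix.vecMul_eq_sum,
        ← Finset.sum_add_sum_compl S, ← ht] at h
      rw [← map_smul, ← h, map_add, map_sum, Finset.sum_eq_zero, zero_add]
      intro i hi
      rw [map_smul, LinearMap.mem_ker.mp (hv i hi), smul_zero]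
    refine ⟨(LinearMap.ker φ).liftQ t hker ∘ₗ (φ.quotKerEquivOfSurjective hφ).symm.toLinearMap, ?_⟩
    ext q
    obtain ⟨u, rfl⟩ := hφ q
    have : (φ.quotKerEquivOfSurjective hφ).symm (φ u) = (LinearMap.ker φ).mkQ u := by
      rw [LinearEquiv.symm_apply_eq]
      rfl
    simp [this, hφt]
  obtain ⟨s, hs⟩ : (1 : B) ∈ J := hJ (h1 ▸ Submodule.mem_top)
  rw [one_smul] at hs
  exact Module.Projective.of_split s φ hs

end minorIdeal

/-! ### Relations between generators modulo a submodule -/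

/-- The coefficient tuples of linear combinations of `x` lying in `N`. -/
def relationModule {B ι X : Type*} [CommRing B] [Fintype ι] [AddCommGroup X] [Module B X]
    (N : Submodule B X) (x : ι → X) : Submodule B (ι → B) :=
  N.comap (Fintype.linearCombination B x)

section relationModule

variable {B ι X : Type*} [CommRing B] [Fintype ι] [AddCommGroup X] [Module B X]

theorem mem_relationModule {N : Submodule B X} {x : ι → X} {u : ι → B} :
    u ∈ relationModule N x ↔ ∑ i, u i • x i ∈ N := Iff.rfl

theorem projective_map_mkQ_of_minorIdeal [DecidableEq ι] (N : Submodule B X) (x : ι → X)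
    (S : Finset ι) (h1 : minorIdeal (relationModule N x) S = ⊤)
    (h0 : ∀ j ∉ S, minorIdeal (relationModule N x) (insert j S) = ⊥) :
    Module.Projective B ((Submodule.span B (Set.range x)).map N.mkQ) := by
  have hr : LinearMap.range (N.mkQ ∘ₗ Fintype.linearCombination B x) =
      (Submodule.span B (Set.range x)).map N.mkQ := by
    rw [LinearMap.range_comp, Fintype.range_linearCombination]
  have hk : LinearMap.ker (N.mkQ ∘ₗ Fintype.linearCombination B x).rangeRestrict =
      relationModule N x := by
    rw [LinearMap.ker_rangeRestrict, LinearMap.ker_comp, Submodule.ker_mkQ]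
    rfl
  rw [← hr]
  refine projective_of_minorIdeal _ (LinearMap.surjective_rangeRestrict _) S ?_ ?_ <;> rwa [hk]

/-- Padded by zeros, any two tuples with the same span differ by an invertible matrix. -/
theorem exists_linearEquiv_padded {x y : ι → X}
    (h : Submodule.span B (Set.range x) = Submodule.span B (Set.range y)) :
    ∃ U : (ι ⊕ ι → B) ≃ₗ[B] (ι ⊕ ι → B), ∀ u,
      Fintype.linearCombination B (Sum.elim y 0) (U u) =
        Fintype.linearCombination B (Sum.elim x 0) u := by
  have factor {x y : ι → X} (h : Submodule.span B (Set.range x) ≤ Submodule.span B (Set.range y)) :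
      ∃ C : (ι → B) →ₗ[B] (ι → B),
        Fintype.linearCombination B y ∘ₗ C = Fintype.linearCombination B x := by
    have hx (u) : Fintype.linearCombination B x u ∈
        LinearMap.range (Fintype.linearCombination B y) := by
      rw [Fintype.range_linearCombination]
      refine h ?_
      rw [← Fintype.range_linearCombination]
      exact ⟨u, rfl⟩
    obtain ⟨C, hC⟩ := Module.projective_lifting_property
      (Fintype.linearCombination B y).rangeRestrict
      ((Fintype.linearCombination B x).codRestrict _ hx) (LinearMap.surjective_rangeRestrict _)
    exact ⟨C, LinearMap.ext fun u => congrArg Subtype.val (LinearMap.congr_fun hC u)⟩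
  obtain ⟨C, hC⟩ := factor h.le
  obtain ⟨D, hD⟩ := factor h.ge
  have hC' (a) : Fintype.linearCombination B y (C a) = Fintype.linearCombination B x a :=
    LinearMap.congr_fun hC a
  have hD' (a) : Fintype.linearCombination B x (D a) = Fintype.linearCombination B y a :=
    LinearMap.congr_fun hD a
  have hpad (z : ι → X) (p : (ι → B) × (ι → B)) : Fintype.linearCombination B (Sum.elim z 0)
      ((LinearEquiv.sumArrowLequivProdArrow ι ι B B).symm p) =
        Fintype.linearCombination B z p.1 := by
    simp only [Fintype.linearCombination_apply, Fintype.sum_sum_type, Sum.elim_inl, Sum.elim_inr,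
      Pi.zero_apply, smul_zero, Finset.sum_const_zero, add_zero]
    rfl
  -- Product of the shears by `-D` and by `C`, followed by a swap of the two blocks. It is
  -- invertible even though `C` and `D` need not be.
  let V : ((ι → B) × (ι → B)) ≃ₗ[B] ((ι → B) × (ι → B)) :=
    { toFun := fun p => (C (p.1 - D p.2) + p.2, p.1 - D p.2)
      invFun := fun q => (q.2 + D (q.1 - C q.2), q.1 - C q.2)
      map_add' := fun p q => by ext <;> simp <;> ring
      map_smul' := fun c p => by ext <;> simp <;> ring
      left_inv := fun p => by ext <;> simp
      right_inv := fun q => by ext <;> simp }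
  let e := LinearEquiv.sumArrowLequivProdArrow ι ι B B
  refine ⟨e.trans (V.trans e.symm), fun u => ?_⟩
  obtain ⟨p, rfl⟩ := e.symm.surjective u
  rw [hpad]
  simp only [LinearEquiv.trans_apply, LinearEquiv.apply_symm_apply]
  rw [hpad]
  change Fintype.linearCombination B y (C (p.1 - D p.2) + p.2) = _
  rw [map_add, hC', map_sub, hD', sub_add_cancel]

/-- The ideal of minors of the relations modulo `N` between the entries of `x`, padded by zeros. -/
def relationIdeal [DecidableEq ι] (N : Submodule B X) (x : ι → X) (S : Finset (ι ⊕ ι)) : Ideal B :=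
  minorIdeal (relationModule N (Sum.elim x 0)) S

variable [DecidableEq ι]

theorem relationIdeal_le_of_span_eq (N : Submodule B X) {x y : ι → X}
    (h : Submodule.span B (Set.range x) = Submodule.span B (Set.range y)) (S : Finset (ι ⊕ ι)) :
    relationIdeal N x S ≤ relationIdeal N y S := by
  obtain ⟨U, hU⟩ := exists_linearEquiv_padded h
  refine minorIdeal_le_of_linearEquiv U (fun u hu => ?_) S
  change Fintype.linearCombination B _ (U u) ∈ N
  rw [hU]
  exact hu

/-- A `σ`-semilinear map preserving `N` turns relations among `x` into relations among `g ∘ x`, a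
tuple with the same span. -/
theorem relationIdeal_map_le (σ : B →+* B) (g : X →+ X)
    (hg : ∀ (b : B) (m : X), g (b • m) = σ b • g m) {N : Submodule B X}
    (hN : ∀ m ∈ N, g m ∈ N) {x : ι → X}
    (hx : Submodule.span B (Set.range fun i => g (x i)) = Submodule.span B (Set.range x))
    (S : Finset (ι ⊕ ι)) : (relationIdeal N x S).map σ ≤ relationIdeal N x S := by
  refine le_trans ?_ (relationIdeal_le_of_span_eq N hx S)
  refine map_minorIdeal_le σ (fun u hu => ?_) S
  rw [mem_relationModule] at hu ⊢
  have := hN _ hu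
  rw [map_sum] at this
  convert this using 2 with i
  rw [hg]
  cases i <;> simp

end relationModule

/-! ### Scalar extension from `A` to `R ⊗ A` -/

namespace GroupFunctor

section tensorModule

variable {k : Type u} [Field k] (R : Type v) [CommRing R] [Algebra k R]
  (A : Type u₁) [CommRing A] [Algebra k A]
  (M : Type u₂) [AddCommGroup M] [Module k M] [Module A M] [IsScalarTower k A M]

theorem tensorSMul_one (m : R ⊗[k] M) : tensorSMul R A M 1 m = m := by
  induction m with
  | zero => simp
  | add x y hx hy => rw [map_add, hx, hy]
  | tmul r m => rw [Algebra.TensorProduct.one_def, tensorSMul_tmul, one_mul, one_smul]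

theorem tensorSMul_mul (a b : R ⊗[k] A) (m : R ⊗[k] M) :
    tensorSMul R A M (a * b) m = tensorSMul R A M a (tensorSMul R A M b m) := by
  induction m with
  | zero => simp
  | add x y hx hy => simp only [map_add, hx, hy]
  | tmul r m =>
    induction b with
    | zero => simp
    | add x y hx hy => simp only [mul_add, map_add, LinearMap.add_apply, hx, hy]
    | tmul s b =>
      induction a with
      | zero => simp
      | add x y hx hy => simp only [add_mul, map_add, LinearMap.add_apply, hx, hy]
      | tmul t a =>
        simp only [Algebra.TensorProduct.tmul_mul_tmul, tensorSMul_tmul, mul_assoc, mul_smul]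

theorem tensorSMul_algebraMap (c : R) (m : R ⊗[k] M) :
    tensorSMul R A M (c ⊗ₜ 1) m = c • m := by
  induction m with
  | zero => simp
  | add x y hx hy => rw [map_add, hx, hy, smul_add]
  | tmul r m => rw [tensorSMul_tmul, one_smul, TensorProduct.smul_tmul', smul_eq_mul]

/-- The `R ⊗ A`-module structure on `R ⊗ M` given by `tensorSMul`. -/
@[reducible]
noncomputable def tensorModule : Module (R ⊗[k] A) (R ⊗[k] M) where
  smul a m := tensorSMul R A M a m
  one_smul := tensorSMul_one R A M
  mul_smul := tensorSMul_mul R A M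
  smul_zero a := map_zero _
  smul_add a := map_add _
  add_smul a b m := by
    change tensorSMul R A M (a + b) m = tensorSMul R A M a m + tensorSMul R A M b m
    rw [map_add, LinearMap.add_apply]
  zero_smul m := by
    change tensorSMul R A M 0 m = 0
    rw [map_zero, LinearMap.zero_apply]

attribute [local instance] tensorModule

variable {R A M}

theorem tensorModule_smul (a : R ⊗[k] A) (m : R ⊗[k] M) : a • m = tensorSMul R A M a m := rfl

theorem tmul_smul_tmul (r s : R) (a : A) (m : M) :
    (r ⊗ₜ[k] a : R ⊗[k] A) • (s ⊗ₜ[k] m : R ⊗[k] M) = (r * s) ⊗ₜ[k] (a • m) := rfl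

variable (R) in
/-- The scalar extension of an `A`-submodule as a submodule over `R ⊗ A`. -/
noncomputable def tensorSubmodule (N : Submodule A M) : Submodule (R ⊗[k] A) (R ⊗[k] M) where
  __ := ((N.restrictScalars k).baseChange R).toAddSubmonoid
  smul_mem' a m hm := by
    change a • m ∈ (N.restrictScalars k).baseChange R
    change m ∈ (N.restrictScalars k).baseChange R at hm
    rw [Submodule.baseChange_eq_span] at hm
    induction hm using Submodule.span_induction with
    | zero => rw [smul_zero]; exact zero_mem _
    | add x y _ _ hx hy => rw [smul_add]; exact add_mem hx hy
    | smul c x _ hx =>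
      rw [← tensorSMul_algebraMap R A M, ← tensorModule_smul, ← mul_smul, mul_comm, mul_smul,
        tensorModule_smul (c ⊗ₜ 1), tensorSMul_algebraMap]
      exact Submodule.smul_mem _ _ hx
    | mem x hx =>
      obtain ⟨n, hn, rfl⟩ := hx
      induction a with
      | zero => rw [zero_smul]; exact zero_mem _
      | add x y hx hy => rw [add_smul]; exact add_mem hx hy
      | tmul r a =>
        exact Submodule.tmul_mem_baseChange_of_mem _ (N.smul_mem a hn)

theorem mem_tensorSubmodule {N : Submodule A M} {m : R ⊗[k] M} :
    m ∈ tensorSubmodule R N ↔ m ∈ (N.restrictScalars k).baseChange R := Iff.rfl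

theorem tensorSubmodule_span (s : Set M) :
    tensorSubmodule R (Submodule.span A s) =
      Submodule.span (R ⊗[k] A) ((fun m : M => (1 : R) ⊗ₜ[k] m) '' s) := by
  refine le_antisymm (fun m hm => ?_) (Submodule.span_le.mpr ?_)
  · rw [mem_tensorSubmodule, Submodule.baseChange_eq_span] at hm
    induction hm using Submodule.span_induction with
    | zero => exact zero_mem _
    | add x y _ _ hx hy => exact add_mem hx hy
    | smul c x _ hx =>
      rw [← tensorSMul_algebraMap R A M]
      exact Submodule.smul_mem _ _ hx
    | mem x hx =>
      obtain ⟨n, hn, rfl⟩ := hx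
      change n ∈ Submodule.span A s at hn
      change (1 : R) ⊗ₜ[k] n ∈ _
      induction hn using Submodule.span_induction with
      | zero => rw [TensorProduct.tmul_zero]; exact zero_mem _
      | add x y _ _ hx hy => rw [TensorProduct.tmul_add]; exact add_mem hx hy
      | smul c x _ hx =>
        rw [show (1 : R) ⊗ₜ[k] (c • x) = ((1 : R) ⊗ₜ[k] c : R ⊗[k] A) • ((1 : R) ⊗ₜ[k] x) by
          rw [tmul_smul_tmul, mul_one]]
        exact Submodule.smul_mem _ _ hx
      | mem x hx => exact Submodule.subset_span ⟨x, hx, rfl⟩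
  · rintro _ ⟨n, hn, rfl⟩
    exact Submodule.tmul_mem_baseChange_of_mem _ (Submodule.subset_span hn)

theorem mem_baseChange_ideal {I : Ideal A} {a : R ⊗[k] A} :
    a ∈ (I.restrictScalars k).baseChange R ↔
      a ∈ I.map (Algebra.TensorProduct.includeRight : A →ₐ[k] R ⊗[k] A) := by
  have h := Ideal.map_includeRight_eq (R := k) (A := R) I
  rw [← Submodule.restrictScalars_mem k (Ideal.map _ I), h]
  rfl

variable {ι : Type*} [Fintype ι]

/-- The relations are the kernel of `A^ι → M ⧸ N`, and tensoring with `R`, flat over the field `k`,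
preserves this exactness. -/
theorem relationModule_tensorSubmodule_le (N : Submodule A M) (x : ι → M) :
    relationModule (tensorSubmodule R N) (fun i => (1 : R) ⊗ₜ[k] x i) ≤
      Submodule.span (R ⊗[k] A)
        ((fun u : ι → A => (Algebra.TensorProduct.includeRight : A →ₐ[k] R ⊗[k] A) ∘ u) ''
          relationModule N x) := by
  classical
  intro b hb
  rw [mem_relationModule, mem_tensorSubmodule] at hb
  let e := TensorProduct.piRight k k R (fun _ : ι => A)
  let L : (ι → A) →ₗ[k] M := (Fintype.linearCombination A x).restrictScalars k
  let q : M →ₗ[k] M ⧸ N := N.mkQ.restrictScalars k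
  have he (w : R ⊗[k] (ι → A)) : L.lTensor R w = ∑ i, e w i • ((1 : R) ⊗ₜ[k] x i) := by
    induction w with
    | zero => simp
    | add a b ha hb => simp only [map_add, Pi.add_apply, add_smul, Finset.sum_add_distrib, ha, hb]
    | tmul r u =>
      simp only [e, L, LinearMap.lTensor_tmul, LinearMap.coe_restrictScalars,
        Fintype.linearCombination_apply, TensorProduct.tmul_sum, TensorProduct.piRight_apply,
        TensorProduct.piRightHom_tmul, tmul_smul_tmul, mul_one]
  have hq (m) (hm : m ∈ (N.restrictScalars k).baseChange R) : q.lTensor R m = 0 := by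
    rw [Submodule.baseChange_eq_span] at hm
    refine (Submodule.span_le (p := LinearMap.ker (q.baseChange R))).mpr ?_ hm
    rintro _ ⟨n, hn, rfl⟩
    change (1 : R) ⊗ₜ[k] q n = 0
    rw [show q n = 0 from (Submodule.Quotient.mk_eq_zero N).mpr hn, TensorProduct.tmul_zero]
  have hex : Function.Exact ((relationModule N x).subtype.restrictScalars k) (q ∘ₗ L) := by
    intro u
    rw [LinearMap.comp_apply]
    refine (Submodule.Quotient.mk_eq_zero N).trans ⟨fun h => ⟨⟨u, h⟩, rfl⟩, ?_⟩
    rintro ⟨u, rfl⟩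
    exact u.2
  have hw : (q ∘ₗ L).lTensor R (e.symm b) = 0 := by
    rw [LinearMap.lTensor_comp, LinearMap.comp_apply, he, e.apply_symm_apply]
    exact hq _ hb
  obtain ⟨w, hw⟩ := (Module.Flat.lTensor_exact R hex _).mp hw
  rw [← e.apply_symm_apply b, ← hw]
  clear hw hb
  induction w with
  | zero => simp
  | add a b ha hb => rw [map_add, map_add]; exact add_mem ha hb
  | tmul r u =>
    have : e (((relationModule N x).subtype.restrictScalars k).lTensor R (r ⊗ₜ u)) =
        (r ⊗ₜ[k] (1 : A)) • ((Algebra.TensorProduct.includeRight : A →ₐ[k] R ⊗[k] A) ∘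
          (u : ι → A)) := by
      ext i
      simp [e]
    rw [this]
    exact Submodule.smul_mem _ _ (Submodule.subset_span ⟨u, u.2, rfl⟩)

theorem includeRight_comp_mem_relationModule {N : Submodule A M} {x : ι → M} {u : ι → A}
    (hu : u ∈ relationModule N x) :
    (Algebra.TensorProduct.includeRight : A →ₐ[k] R ⊗[k] A) ∘ u ∈
      relationModule (tensorSubmodule R N) (fun i => (1 : R) ⊗ₜ[k] x i) := by
  rw [mem_relationModule] at hu ⊢
  simp only [Function.comp_apply, Algebra.TensorProduct.includeRight_apply, tmul_smul_tmul, mul_one,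
    ← TensorProduct.tmul_sum]
  exact Submodule.tmul_mem_baseChange_of_mem _ hu

theorem map_relationIdeal_includeRight [DecidableEq ι] (N : Submodule A M) (x : ι → M)
    (S : Finset (ι ⊕ ι)) :
    (relationIdeal N x S).map (Algebra.TensorProduct.includeRight : A →ₐ[k] R ⊗[k] A) =
      relationIdeal (tensorSubmodule R N) (fun i => (1 : R) ⊗ₜ[k] x i) S := by
  have h : Sum.elim (fun i => (1 : R) ⊗ₜ[k] x i) 0 =
      fun i => (1 : R) ⊗ₜ[k] (Sum.elim x 0 : ι ⊕ ι → M) i := by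
    ext i
    cases i <;> simp
  rw [relationIdeal, relationIdeal, h]
  let f : A →+* R ⊗[k] A := (Algebra.TensorProduct.includeRight : A →ₐ[k] R ⊗[k] A)
  exact le_antisymm (map_minorIdeal_le f (fun u hu => includeRight_comp_mem_relationModule hu) S)
    (minorIdeal_le_map f (relationModule_tensorSubmodule_le N _) S)

end tensorModule

/-! ### Stability of the relation ideals and of sums -/

section stable

variable {k : Type u} [Field k] {G : GroupKFunctor.{u, v, w} k} {A : Type u₁} [CommRing A]
  [Algebra k A] {α : AlgebraAction G A} {M : Type u₂} [AddCommGroup M] [Module k M] [Module A M]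
  [IsScalarTower k A M]

theorem GModule.act_inv_act {V : Type*} [AddCommGroup V] [Module k V] (ρ : GModule G V)
    (R : CommAlgCat.{v} k) (g : G.obj R) (m : R ⊗[k] V) : ρ.act R g (ρ.act R g⁻¹ m) = m := by
  rw [← Module.End.mul_apply, ← map_mul, mul_inv_cancel, map_one, Module.End.one_apply]

/-- The ring endomorphism of `R ⊗ A` given by an element of `G(R)`. -/
noncomputable def AlgebraAction.ringHom (α : AlgebraAction G A) (R : CommAlgCat.{v} k)
    (g : G.obj R) : R ⊗[k] A →+* R ⊗[k] A where
  toFun := α.act R g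
  map_one' := α.act_one R g
  map_mul' := α.act_mul R g
  map_zero' := map_zero _
  map_add' := map_add _

attribute [local instance] tensorModule

theorem AGModule.isStableIdeal_relationIdeal (μ : AGModule α M) {ι : Type*} [Fintype ι]
    [DecidableEq ι] {N : Submodule A M} (hN : μ.IsAGSubmodule N) {x : ι → M}
    (hx : μ.IsAGSubmodule (Submodule.span A (Set.range x))) (S : Finset (ι ⊕ ι)) :
    α.IsStableIdeal (relationIdeal N x S) := by
  intro R g a ha
  rw [mem_baseChange_ideal, map_relationIdeal_includeRight] at ha ⊢
  let y : ι → R ⊗[k] M := fun i => (1 : R) ⊗ₜ[k] x i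
  have hspan : tensorSubmodule R (Submodule.span A (Set.range x)) =
      Submodule.span (R ⊗[k] A) (Set.range y) := by
    rw [tensorSubmodule_span, ← Set.range_comp]
    rfl
  have hstable (g : G.obj R) (m) (hm : m ∈ Submodule.span (R ⊗[k] A) (Set.range y)) :
      μ.act R g m ∈ Submodule.span (R ⊗[k] A) (Set.range y) := by
    rw [← hspan] at hm ⊢
    exact hx R g m hm
  refine relationIdeal_map_le (α.ringHom R g) (μ.act R g).toAddMonoidHom (μ.act_smul R g)
    (hN R g) ?_ S (Ideal.mem_map_of_mem (α.ringHom R g) ha)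
  refine le_antisymm (Submodule.span_le.mpr ?_) (Submodule.span_le.mpr ?_)
  · rintro _ ⟨i, rfl⟩
    exact hstable g _ (Submodule.subset_span ⟨i, rfl⟩)
  · rintro _ ⟨i, rfl⟩
    -- Writing `y i = g (g⁻¹ y i)` with `g⁻¹ y i` in the span shows that the tuple `g (y j)` still
    -- generates.
    have h := hstable g⁻¹ (y i) (Submodule.subset_span ⟨i, rfl⟩)
    change y i ∈ _
    rw [← μ.act_inv_act R g (y i)]
    generalize μ.act R g⁻¹ (y i) = z at h
    induction h using Submodule.span_induction with
    | zero => rw [map_zero]; exact zero_mem _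
    | add x y _ _ hx hy => rw [map_add]; exact add_mem hx hy
    | smul c x _ hx =>
      rw [tensorModule_smul, μ.act_smul]
      exact Submodule.smul_mem _ _ hx
    | mem x hx =>
      obtain ⟨j, rfl⟩ := hx
      exact Submodule.subset_span ⟨j, rfl⟩

theorem AGModule.isAGSubmodule_sSup (μ : AGModule α M) {T : Set (Submodule A M)}
    (hT : ∀ N ∈ T, μ.IsAGSubmodule N) : μ.IsAGSubmodule (sSup T) := by
  intro R g m hm
  rw [Submodule.baseChange_eq_span] at hm
  refine (Submodule.span_le
    (p := (((sSup T).restrictScalars k).baseChange R).comap (μ.act R g))).mpr ?_ hm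
  rintro _ ⟨n, hn, rfl⟩
  change n ∈ sSup T at hn
  change μ.act R g ((1 : R) ⊗ₜ[k] n) ∈ ((sSup T).restrictScalars k).baseChange R
  rw [sSup_eq_iSup'] at hn
  induction hn using Submodule.iSup_induction' with
  | zero => rw [TensorProduct.tmul_zero, map_zero]; exact zero_mem _
  | add x y _ _ hx hy => rw [TensorProduct.tmul_add, map_add]; exact add_mem hx hy
  | mem N n hn =>
    have h := hT N N.2 R g ((1 : R) ⊗ₜ[k] n) (Submodule.tmul_mem_baseChange_of_mem _ hn)
    have hle : (N : Submodule A M).restrictScalars k ≤ (sSup T).restrictScalars k :=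
      fun x hx => (le_sSup N.2 : (N : Submodule A M) ≤ sSup T) hx
    have hle' : ((N : Submodule A M).restrictScalars k).baseChange R ≤
        ((sSup T).restrictScalars k).baseChange R := by
      rw [Submodule.baseChange_eq_span, Submodule.baseChange_eq_span]
      exact Submodule.span_mono (Set.image_mono hle)
    exact hle' h

theorem AGModule.isAGSubmodule_sup (μ : AGModule α M) {N F : Submodule A M}
    (hN : μ.IsAGSubmodule N) (hF : μ.IsAGSubmodule F) : μ.IsAGSubmodule (N ⊔ F) := by
  rw [← sSup_pair]
  exact μ.isAGSubmodule_sSup (by rintro _ (rfl | rfl) <;> assumption)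

end stable

end GroupFunctor

/-! ### Relation ideals under localization -/

section localization

variable {A M ι : Type*} [CommRing A] [AddCommGroup M] [Module A M] [Fintype ι] (p : Submonoid A)

theorem relationModule_localized_le (N : Submodule A M) (x : ι → M) :
    relationModule (N.localized p) (fun i => LocalizedModule.mkLinearMap p M (x i)) ≤
      Submodule.span (Localization p)
        ((fun u : ι → A => algebraMap A (Localization p) ∘ u) '' relationModule N x) := by
  intro b hb
  obtain ⟨s, hs⟩ := IsLocalization.exist_integer_multiples_of_finite p b
  choose a ha using hs
  rw [mem_relationModule] at hb
  obtain ⟨n, hn, t, ht⟩ := (Submodule.mem_localized' _ _ _ _ _).mp hb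
  have h : LocalizedModule.mkLinearMap p M ((s : A) • n) =
      LocalizedModule.mkLinearMap p M ((t : A) • ∑ i, a i • x i) := by
    have h1 : LocalizedModule.mkLinearMap p M n =
        (t : A) • ∑ i, b i • LocalizedModule.mkLinearMap p M (x i) := by
      rw [← ht]
      exact (IsLocalizedModule.mk'_cancel' _ n t).symm
    rw [map_smul, h1, map_smul, smul_comm, Finset.smul_sum, map_sum]
    congr 1
    refine Finset.sum_congr rfl fun i _ => ?_
    rw [map_smul, ← algebraMap_smul (Localization p) (a i), ha, smul_assoc]
  obtain ⟨c, hc⟩ := (IsLocalizedModule.eq_iff_exists p _).mp h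
  -- `s` clears the denominators of `b`, `t` that of the element of `N`, and `c` turns an equality
  -- in the localization into one in `M`.
  have hmem : ((c * t : p) : A) • a ∈ relationModule N x := by
    rw [mem_relationModule]
    have : ∑ i, (((c * t : p) : A) • a) i • x i = (c : A) • (s : A) • n := by
      rw [show (c : A) • (s : A) • n = (c : A) • (t : A) • ∑ i, a i • x i from hc]
      simp only [Finset.smul_sum, Pi.smul_apply, smul_eq_mul, Submonoid.coe_mul, mul_smul]
    rw [this]
    exact N.smul_mem _ (N.smul_mem _ hn)
  have hb' : b = IsLocalization.mk' (Localization p) 1 (c * t * s) •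
      (algebraMap A (Localization p) ∘ (((c * t : p) : A) • a)) := by
    ext i
    rw [Pi.smul_apply, Function.comp_apply, Pi.smul_apply, smul_eq_mul, smul_eq_mul, map_mul, ha,
      Algebra.smul_def, ← mul_assoc (algebraMap A _ _), ← map_mul, ← mul_assoc,
      ← Submonoid.coe_mul, IsLocalization.mk'_spec, map_one, one_mul]
  rw [hb']
  exact Submodule.smul_mem _ _ (Submodule.subset_span ⟨_, hmem, rfl⟩)

theorem map_relationIdeal_localized [DecidableEq ι] (N : Submodule A M) (x : ι → M)
    (S : Finset (ι ⊕ ι)) :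
    (relationIdeal N x S).map (algebraMap A (Localization p)) =
      relationIdeal (N.localized p) (fun i => LocalizedModule.mkLinearMap p M (x i)) S := by
  have h : Sum.elim (fun i => LocalizedModule.mkLinearMap p M (x i)) 0 =
      fun i => LocalizedModule.mkLinearMap p M ((Sum.elim x 0 : ι ⊕ ι → M) i) := by
    ext i
    cases i <;> simp
  rw [relationIdeal, relationIdeal, h]
  refine le_antisymm (map_minorIdeal_le _ (fun u hu => ?_) S)
    (minorIdeal_le_map _ (relationModule_localized_le p N _) S)
  rw [mem_relationModule] at hu ⊢
  refine (Submodule.mem_localized' _ _ _ _ _).mpr ⟨_, hu, 1, ?_⟩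
  simp only [IsLocalizedModule.mk'_one, map_sum, map_smul, Function.comp_apply, algebraMap_smul]

end localization

theorem projective_map_mkQ_of_relationIdeal {B X ι : Type*} [CommRing B] [AddCommGroup X]
    [Module B X] [Fintype ι] [DecidableEq ι] (N : Submodule B X) (x : ι → X) (S : Finset (ι ⊕ ι))
    (h1 : relationIdeal N x S = ⊤) (h0 : ∀ j ∉ S, relationIdeal N x (insert j S) = ⊥) :
    Module.Projective B ((Submodule.span B (Set.range x)).map N.mkQ) := by
  have h : Submodule.span B (Set.range x) =
      Submodule.span B (Set.range (Sum.elim x 0 : ι ⊕ ι → X)) := by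
    refine le_antisymm (Submodule.span_mono ?_) (Submodule.span_le.mpr ?_)
    · rintro _ ⟨i, rfl⟩
      exact ⟨Sum.inl i, rfl⟩
    · rintro _ ⟨i | i, rfl⟩
      exacts [Submodule.subset_span ⟨i, rfl⟩, zero_mem _]
  rw [h]
  exact projective_map_mkQ_of_minorIdeal N _ S h1 h0

/-! ### Projectivity and local freeness -/

namespace GroupFunctor

variable {k : Type u} [Field k] {G : GroupKFunctor.{u, v, w} k} {A : Type u₁} [CommRing A]
  [Algebra k A] {α : AlgebraAction G A} {M : Type u₂} [AddCommGroup M] [Module k M] [Module A M]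
  [IsScalarTower k A M]

theorem AGModule.projective_map_mkQ (μ : AGModule α M) (hA : α.IsGSimple) {N F : Submodule A M}
    (hN : μ.IsAGSubmodule N) (hF : μ.IsAGSubmodule F) (hfg : F.FG) :
    Module.Projective A (F.map N.mkQ) := by
  obtain ⟨n, x, rfl⟩ := Submodule.fg_iff_exists_fin_generating_family.mp hfg
  -- The empty set qualifies, since its ideal contains the determinant of the identity. Beyond a
  -- maximal `S`, `G`-simplicity forces the ideals to vanish.
  obtain ⟨S, hS⟩ := (Set.toFinite
    {S : Finset (Fin n ⊕ Fin n) | relationIdeal N x S = ⊤}).exists_maximal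
    ⟨∅, minorIdeal_empty _⟩
  refine projective_map_mkQ_of_relationIdeal N x S hS.prop fun j hj => ?_
  refine (hA _ (μ.isStableIdeal_relationIdeal hN hF _)).resolve_right fun h => hj ?_
  exact hS.le_of_ge h (Finset.subset_insert j S) (Finset.mem_insert_self j S)

theorem AGModule.free_map_mkQ_localized (μ : AGModule α M) (P : Ideal A) [P.IsPrime]
    (hP : ∀ I : Ideal A, α.IsStableIdeal I → I ≤ P → I = ⊥) {N F : Submodule A M}
    (hN : μ.IsAGSubmodule N) (hF : μ.IsAGSubmodule F) (hfg : F.FG) :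
    Module.Free (Localization.AtPrime P)
      ((F.localized P.primeCompl).map (N.localized P.primeCompl).mkQ) := by
  have hfin : Module.Finite (Localization.AtPrime P)
      ((F.localized P.primeCompl).map (N.localized P.primeCompl).mkQ) := by
    obtain ⟨s, rfl⟩ := hfg
    classical
    refine Module.Finite.iff_fg.mpr
      (Submodule.FG.map _ ⟨s.image (LocalizedModule.mkLinearMap _ M), ?_⟩)
    rw [Submodule.localized, Submodule.localized'_span, Finset.coe_image]
  suffices Module.Projective (Localization.AtPrime P)
      ((F.localized P.primeCompl).map (N.localized P.primeCompl).mkQ) from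
    Module.free_of_flat_of_isLocalRing
  clear hfin
  obtain ⟨n, x, rfl⟩ := Submodule.fg_iff_exists_fin_generating_family.mp hfg
  have hspan : (Submodule.span A (Set.range x)).localized P.primeCompl =
      Submodule.span (Localization.AtPrime P)
        (Set.range fun i => LocalizedModule.mkLinearMap P.primeCompl M (x i)) := by
    rw [Submodule.localized, Submodule.localized'_span, ← Set.range_comp]
    rfl
  rw [hspan]
  -- Not lying in `P` replaces being the unit ideal: it yields an element that becomes invertible in
  -- `A_P`, while a stable ideal inside `P` is zero.
  obtain ⟨S, hS⟩ := (Set.toFinite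
    {S : Finset (Fin n ⊕ Fin n) | ¬ relationIdeal N x S ≤ P}).exists_maximal
    ⟨∅, by
      rw [Set.mem_ofPred_eq, relationIdeal, minorIdeal_empty, top_le_iff]
      exact Ideal.IsPrime.ne_top'⟩
  refine projective_map_mkQ_of_relationIdeal _ _ S ?_ fun j hj => ?_
  · refine (map_relationIdeal_localized P.primeCompl N x S).symm.trans ?_
    obtain ⟨d, hd, hdP⟩ := SetLike.not_le_iff_exists.mp hS.prop
    exact Ideal.eq_top_of_isUnit_mem _ (Ideal.mem_map_of_mem _ hd)
      (IsLocalization.map_units (M := P.primeCompl) (Localization.AtPrime P) ⟨d, hdP⟩)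
  · refine (map_relationIdeal_localized P.primeCompl N x _).symm.trans ?_
    rw [hP _ (μ.isStableIdeal_relationIdeal hN hF _), Ideal.map_bot]
    by_contra h
    exact hj (hS.le_of_ge h (Finset.subset_insert j S) (Finset.mem_insert_self j S))

theorem AGModule.projective (μ : AGModule α M) (hM : μ.IsLocallyFinite) (hA : α.IsGSimple) :
    Module.Projective A M := by
  obtain ⟨s, hind, htop, hs⟩ := Submodule.exists_sSupIndep_sSup_eq_top
    {N : Submodule A M | μ.IsAGSubmodule N} (fun C => Module.Projective A C)
    (fun T hT => μ.isAGSubmodule_sSup hT) (fun N hN m => by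
      obtain ⟨F, hF, hfg, hm⟩ := hM m
      have := μ.projective_map_mkQ hA hN hF hfg
      obtain ⟨C, ⟨e⟩, hdisj, hC⟩ := N.exists_disjoint_sup_eq_of_projective F
      exact ⟨C, Module.Projective.of_equiv e, hdisj, by rw [hC]; exact μ.isAGSubmodule_sup hN hF,
        by rw [hC]; exact Submodule.mem_sup_right hm⟩)
  obtain ⟨e⟩ := Submodule.exists_linearEquiv_directSum hind htop
  have (C : s) : Module.Projective A (C : Submodule A M) := hs C C.2
  classical
  exact Module.Projective.of_equiv e

theorem AGModule.free_localizedModule (μ : AGModule α M) (hM : μ.IsLocallyFinite) (P : Ideal A)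
    [P.IsPrime] (hP : ∀ I : Ideal A, α.IsStableIdeal I → I ≤ P → I = ⊥) :
    Module.Free (Localization.AtPrime P) (LocalizedModule P.primeCompl M) := by
  have hsup (T : Set (Submodule A M)) :
      (sSup T).localized P.primeCompl = sSup ((fun N => N.localized P.primeCompl) '' T) := by
    rw [sSup_eq_iSup', sSup_image', Submodule.localized, Submodule.localized'_iSup]
  -- The family consists of localizations of `A,G`-submodules only, as `G` need not act on `M_P`; it
  -- is closed under suprema because localization commutes with them.
  obtain ⟨s, hind, htop, hs⟩ := Submodule.exists_sSupIndep_sSup_eq_top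
    ((fun N : Submodule A M => N.localized P.primeCompl) '' {N | μ.IsAGSubmodule N})
    (fun C => Module.Free (Localization.AtPrime P) C)
    (fun T hT => by
      obtain ⟨T, hT', rfl⟩ := Set.subset_image_iff.mp hT
      exact ⟨sSup T, μ.isAGSubmodule_sSup hT', hsup T⟩)
    (by
      rintro _ ⟨N, hN, rfl⟩ y
      obtain ⟨⟨m, t⟩, rfl⟩ := IsLocalizedModule.mk'_surjective P.primeCompl
        (LocalizedModule.mkLinearMap P.primeCompl M) y
      obtain ⟨F, hF, hfg, hm⟩ := hM m
      have := μ.free_map_mkQ_localized P hP hN hF hfg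
      obtain ⟨C, ⟨e⟩, hdisj, hC⟩ := Submodule.exists_disjoint_sup_eq_of_projective
        (N.localized P.primeCompl) (F.localized P.primeCompl)
      refine ⟨C, Module.Free.of_equiv e, hdisj, ?_, ?_⟩
      · refine hC ▸ ⟨N ⊔ F, μ.isAGSubmodule_sup hN hF, ?_⟩
        simpa [Set.image_pair] using hsup {N, F}
      · exact hC ▸ Submodule.mem_sup_right ⟨m, hm, t, rfl⟩)
  obtain ⟨e⟩ := Submodule.exists_linearEquiv_directSum hind htop
  have (C : s) : Module.Free (Localization.AtPrime P)
    (C : Submodule (Localization.AtPrime P) (LocalizedModule P.primeCompl M)) := hs C C.2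
  classical
  exact Module.Free.of_equiv e

end GroupFunctor

theorem corollary1p3 {k : Type u} [Field k] (G : GroupFunctor.GroupKFunctor.{u, v, w} k)
    {A : Type u₁} [CommRing A] [Algebra k A] (α : GroupFunctor.AlgebraAction G A)
    {M : Type u₂} [AddCommGroup M] [Module k M] [Module A M] [IsScalarTower k A M]
    (μ : GroupFunctor.AGModule α M) (hM : μ.IsLocallyFinite) :
    (∀ (P : Ideal A) [P.IsPrime],
      (∀ I : Ideal A, α.IsStableIdeal I → I ≤ P → I = ⊥) →
        Module.Free (Localization.AtPrime P) (LocalizedModule P.primeCompl M)) ∧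
    (α.IsGSimple → Module.Projective A M) :=
  ⟨fun P _ hP => μ.free_localizedModule hM P hP, μ.projective hM⟩
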